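/- Let $\kappa$ be a regular cardinal, let $\lambda<\kappa$ be an infinite cardinal, and let $M$ be a monoidal category. Assume that the underlying category of $M$ is $\kappa$-accessible, that colimits of $\lambda$-indexed chains (i.e. of all functors $\lambda\to M$, where $\lambda$ is viewed as a well-ordered set) exist in $M$, and that the tensor product functor $\otimes\colon M\times M\to M$ preserves $\kappa$-directed colimits. (a) The category of (coassociative, counital) comonoid objects in $M$ and comonoid morphisms is $\kappa$-accessible. A comonoid object in $M$ is $\kappa$-presentable in this category if and only if its underlying object is $\kappa$-presentable in $M$. (b) Assume additionally that $M$ is a symmetric monoidal category. Then the full subcategory of cocommutative comonoid objects (those whose comultiplication is unchanged by composing with the symmetry) is $\kappa$-accessible. A cocommutative comonoid object is $\kappa$-presentable in this category if and only if its underlying object is $\kappa$-presentable in $M$. Here an object $S$ of a category with $\kappa$-directed colimits is $\kappa$-presentable if $\mathrm{Hom}(S,-)$ preserves $\kappa$-directed colimits, and a (locally small) category is $\kappa$-accessible if it has $\kappa$-directed colimits and there is a set of $\kappa$-presentable objects such that every object is a $\kappa$-directed colimit of objects from this set. -/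

import Mathlib

open CategoryTheory Limits MonoidalCategory

universe w v u

universe v' u'

/-! ### Directed posets and chains closed under a binary operation. -/

section Directed

variable {J : Type w} [PartialOrder J] {κ : Cardinal.{w}} [Fact κ.IsRegular]
  [IsCardinalFiltered J κ]

/-! Let `C` be a comonoid, its underlying object written as a `κ`-directed colimit of
`κ`-presentable objects `F j`. The comultiplication restricted to `F j` lifts to some `δ j : F j ⟶ F
(n j) ⊗ F (n j)`, and the compatibility of these lifts, coassociativity and the counit laws each
hold after passing to a later stage. A chain of length `lam` that is closed, up to cofinality, under
all these later stages has a colimit `X`, which is `κ`-presentable because `lam < κ`. The `δ j` glue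
to a comultiplication on `X`, and the counit is that of `C` restricted. Only maps out of `X` are
involved, so the tensor product need not preserve the colimit of the chain. This is
`exists_isComonHom_factorization`; it also makes fewer than `κ` prescribed maps into `X` comonoid
morphisms.

It follows that the comonoids over `C` with `κ`-presentable underlying object form a `κ`-filtered
category, final in the canonical diagram of `κ`-presentable objects of `M` over `C`
(`final_underlyingCostructuredArrow`). The colimit of that diagram is `C`, and the forgetful functor
reflects colimits. Such comonoids are `κ`-presentable, and every `κ`-presentable comonoid is a
retract of one.

Both parts are instances of one statement about a category `K` embedded fully faithfully in `Comon
M` with essential image cut out by `Δ ≫ τ = Δ`. -/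

variable (κ) in
lemma exists_forall_le_of_hasCardinalLT {ι : Type*} (f : ι → J) (h : HasCardinalLT ι κ) :
    ∃ j, ∀ i, f i ≤ j :=
  ⟨_, fun i ↦ leOfHom (IsCardinalFiltered.toMax f h i)⟩

include κ in
variable (κ) in
lemma exists_le_le_of_isCardinalFiltered (j k : J) : ∃ l, j ≤ l ∧ k ≤ l := by
  have := isFiltered_of_isCardinalFiltered J κ
  exact ⟨_, leOfHom (IsFiltered.leftToMax j k), leOfHom (IsFiltered.rightToMax j k)⟩

/-- In a `κ`-directed poset, there is a chain of any length less than `κ` that is closed under a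
given binary function. -/
lemma exists_monotone_forall_exists_le (Λ : Type w) [LinearOrder Λ] [WellFoundedLT Λ]
    [NoMaxOrder Λ] (hΛ : HasCardinalLT Λ κ) (r : J → J → J)
    (hr : ∀ j k, j ≤ r j k) :
    ∃ a : Λ → J, Monotone a ∧ ∀ α β, ∃ γ, r (a α) (a β) ≤ a γ := by
  have hκ : Cardinal.aleph0 ≤ κ := Cardinal.IsRegular.aleph0_le Fact.out
  have hI (α : Λ) : HasCardinalLT (Set.Iio α × Set.Iio α) κ :=
    hasCardinalLT_prod hκ (hΛ.of_injective _ Subtype.val_injective)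
      (hΛ.of_injective _ Subtype.val_injective)
  let ub (α : Λ) (f : Set.Iio α → J) : J :=
    (exists_forall_le_of_hasCardinalLT κ
      (fun p : Set.Iio α × Set.Iio α ↦ r (f p.1) (f p.2)) (hI α)).choose
  have hub (α : Λ) (f : Set.Iio α → J) (β γ : Set.Iio α) : r (f β) (f γ) ≤ ub α f :=
    (exists_forall_le_of_hasCardinalLT κ
      (fun p : Set.Iio α × Set.Iio α ↦ r (f p.1) (f p.2)) (hI α)).choose_spec (β, γ)
  -- By well-founded recursion, `a α` bounds the values of `r` on all pairs of earlier terms; there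
  -- are fewer than `κ` such pairs.
  let a : Λ → J := wellFounded_lt.fix (fun α ih ↦ ub α (fun β ↦ ih β.1 β.2))
  have ha (α : Λ) : a α = ub α (fun β ↦ a β) := wellFounded_lt.fix_eq _ α
  have hlt {α β γ : Λ} (h₁ : β < α) (h₂ : γ < α) : r (a β) (a γ) ≤ a α := by
    conv_rhs => rw [ha]
    exact hub α (fun β ↦ a β) ⟨β, h₁⟩ ⟨γ, h₂⟩
  refine ⟨a, fun α β h ↦ ?_, fun α β ↦ ?_⟩
  · obtain rfl | h := h.eq_or_lt
    · exact le_rfl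
    · exact (hr _ _).trans (hlt h h)
  · obtain ⟨γ, hγ⟩ := exists_gt (max α β)
    exact ⟨γ, hlt ((le_max_left _ _).trans_lt hγ) ((le_max_right _ _).trans_lt hγ)⟩

end Directed

namespace CategoryTheory

/-! ### Accessibility of the tensor square and cube. -/

section

section

variable {C : Type*} [Category* C] {D : Type*} [Category* D] {E : Type*} [Category* E]

instance preservesColimitsOfShape_prod' {J : Type*} [Category* J] (F : C ⥤ D) (G : C ⥤ E)
    [PreservesColimitsOfShape J F] [PreservesColimitsOfShape J G] :
    PreservesColimitsOfShape J (F.prod' G) where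
  preservesColimit := ⟨fun hc ↦ ⟨{
    desc s := ((isColimitOfPreserves F hc).desc ((Prod.fst D E).mapCocone s),
      (isColimitOfPreserves G hc).desc ((Prod.snd D E).mapCocone s))
    fac s j := Prod.ext ((isColimitOfPreserves F hc).fac ((Prod.fst D E).mapCocone s) j)
      ((isColimitOfPreserves G hc).fac ((Prod.snd D E).mapCocone s) j)
    uniq s m hm := Prod.ext
      ((isColimitOfPreserves F hc).uniq ((Prod.fst D E).mapCocone s) m.1
        (fun j ↦ (Prod.hom_ext_iff.1 (hm j)).1))
      ((isColimitOfPreserves G hc).uniq ((Prod.snd D E).mapCocone s) m.2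
        (fun j ↦ (Prod.hom_ext_iff.1 (hm j)).2)) }⟩⟩

instance isCardinalAccessible_prod' (F : C ⥤ D) (G : C ⥤ E) (κ : Cardinal.{w})
    [Fact κ.IsRegular] [F.IsCardinalAccessible κ] [G.IsCardinalAccessible κ] :
    (F.prod' G).IsCardinalAccessible κ where
  preservesColimitOfShape J _ _ := by
    have := F.preservesColimitsOfShape_of_isCardinalAccessible κ J
    have := G.preservesColimitsOfShape_of_isCardinalAccessible κ J
    infer_instance

end

variable (M : Type u) [Category.{v} M] [MonoidalCategory M]

/-- The functor `X ↦ X ⊗ X`. -/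
def tensorSquare : M ⥤ M where
  obj X := X ⊗ X
  map f := f ⊗ₘ f

/-- The functor `X ↦ X ⊗ (X ⊗ X)`. -/
def tensorCube : M ⥤ M where
  obj X := X ⊗ (X ⊗ X)
  map f := f ⊗ₘ (f ⊗ₘ f)

variable (κ : Cardinal.{w}) [Fact κ.IsRegular] [(tensor M).IsCardinalAccessible κ]

instance : (tensorSquare M).IsCardinalAccessible κ :=
  inferInstanceAs (((𝟭 M).prod' (𝟭 M) ⋙ tensor M).IsCardinalAccessible κ)

instance : (tensorCube M).IsCardinalAccessible κ :=
  inferInstanceAs (((𝟭 M).prod' (tensorSquare M) ⋙ tensor M).IsCardinalAccessible κ)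

end

/-! ### Colimits along chains in a poset. -/

section

/-- A colimit of the restriction of a functor `F : J ⥤ C`, with `J` a poset, to a subset `S` of `J`,
with its cocone maps extended to the lower closure of `S`. -/
structure RestrictedColimit {C : Type u} [Category.{v} C] {J : Type w} [PartialOrder J]
    (F : J ⥤ C) (S : Set J) where
  /-- the colimit object -/
  pt : C
  /-- the cocone maps -/
  ι (j : J) (hj : j ∈ lowerClosure S) : F.obj j ⟶ pt
  map_ι {j k : J} (h : j ≤ k) (hk : k ∈ lowerClosure S) :
    F.map (homOfLE h) ≫ ι k hk = ι j ((lowerClosure S).lower h hk)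
  exists_desc {Z : C} (f : ∀ j ∈ S, F.obj j ⟶ Z)
    (hf : ∀ j (hj : j ∈ S) k (hk : k ∈ S) (h : j ≤ k), F.map (homOfLE h) ≫ f k hk = f j hj) :
    ∃ g : pt ⟶ Z, ∀ j hj, ι j (subset_lowerClosure hj) ≫ g = f j hj
  hom_ext {Z : C} {f g : pt ⟶ Z} (h : ∀ j (hj : j ∈ S),
    ι j (subset_lowerClosure hj) ≫ f = ι j (subset_lowerClosure hj) ≫ g) : f = g

section

variable {C : Type u} [Category.{v} C] {κ : Cardinal.{w}} [Fact κ.IsRegular]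
  {J : Type w} [PartialOrder J]

/-- The colimit of the restriction of a functor along a monotone map from a linear order. -/
noncomputable def RestrictedColimit.ofMonotone (F : J ⥤ C) {Λ : Type w} [LinearOrder Λ]
    [HasColimitsOfShape Λ C] {a : Λ → J} (ha : Monotone a) :
    RestrictedColimit F (Set.range a) :=
  have hL {j : J} (hj : j ∈ lowerClosure (Set.range a)) : ∃ α, j ≤ a α := by
    obtain ⟨_, ⟨α, rfl⟩, h⟩ := hj
    exact ⟨α, h⟩
  let i (α : Λ) : F.obj (a α) ⟶ colimit (ha.functor ⋙ F) := colimit.ι (ha.functor ⋙ F) α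
  have hi {α β : Λ} (h : α ≤ β) : F.map (homOfLE (ha h)) ≫ i β = i α :=
    colimit.w (ha.functor ⋙ F) (homOfLE h)
  have map_i {j k : J} {α : Λ} (h₁ : j ≤ k) (h₂ : k ≤ a α) :
      F.map (homOfLE h₁) ≫ F.map (homOfLE h₂) ≫ i α = F.map (homOfLE (h₁.trans h₂)) ≫ i α := by
    rw [← F.map_comp_assoc, homOfLE_comp]
  -- Linearity of `Λ` makes the leg at `j` independent of the chosen chain element above `j`.
  have aux {j : J} {α β : Λ} (hα : j ≤ a α) (hβ : j ≤ a β) :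
      F.map (homOfLE hα) ≫ i α = F.map (homOfLE hβ) ≫ i β := by
    wlog h : α ≤ β generalizing α β
    · exact (this hβ hα (le_of_not_ge h)).symm
    rw [← hi h, map_i]
  have self {α : Λ} (h : a α ≤ a α) : F.map (homOfLE h) ≫ i α = i α :=
    hi le_rfl
  { pt := colimit (ha.functor ⋙ F)
    ι j hj := F.map (homOfLE (hL hj).choose_spec) ≫ i (hL hj).choose
    map_ι {j k} h hk := by
      rw [map_i]
      exact aux _ _
    exists_desc {Z} f hf := ⟨colimit.desc (ha.functor ⋙ F)
        { pt := Z
          ι.app α := f (a α) ⟨α, rfl⟩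
          ι.naturality α β h := by
            simpa using! hf _ _ _ _ (ha (leOfHom h)) }, by
      rintro _ ⟨α, rfl⟩
      rw [aux _ le_rfl, self]
      exact colimit.ι_desc _ _⟩
    hom_ext {Z f g} h := colimit.hom_ext fun α ↦ by
      have := h (a α) ⟨α, rfl⟩
      rwa [aux _ le_rfl, self] at this }

/-- The chain closed under `r` has fewer than `κ` arrows, so its colimit stays `κ`-presentable. The
values of `r` lie below chain elements but need not be chain elements, whence the lower closure. -/
lemma exists_restrictedColimit [LocallySmall.{w} C] [IsCardinalFiltered J κ]
    (F : J ⥤ C) [∀ j, IsCardinalPresentable (F.obj j) κ]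
    (Λ : Type w) [LinearOrder Λ] [WellFoundedLT Λ]
    [NoMaxOrder Λ] [Nonempty Λ] [HasColimitsOfShape Λ C] (hΛ : HasCardinalLT Λ κ)
    (r : J → J → J) (hr : ∀ j k, j ≤ r j k) :
    ∃ (S : Set J) (c : RestrictedColimit F S), S.Nonempty ∧ IsCardinalPresentable c.pt κ ∧
      ∀ j ∈ S, ∀ k ∈ S, r j k ∈ lowerClosure S := by
  obtain ⟨a, ha, h⟩ := exists_monotone_forall_exists_le Λ hΛ r hr
  have hκ : Cardinal.aleph0 ≤ κ := Cardinal.IsRegular.aleph0_le Fact.out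
  refine ⟨Set.range a, .ofMonotone F ha, Set.range_nonempty a, ?_, ?_⟩
  · have (α : Λ) : IsCardinalPresentable ((ha.functor ⋙ F).obj α) κ :=
      inferInstanceAs (IsCardinalPresentable (F.obj (a α)) κ)
    refine isCardinalPresentable_of_isColimit _ (colimit.isColimit (ha.functor ⋙ F)) κ
      ((hasCardinalLT_prod hκ hΛ hΛ).of_injective
        (fun f : Arrow Λ ↦ (f.left, f.right)) fun f g hfg ↦ ?_)
    obtain ⟨h₁, h₂⟩ := Prod.mk.inj hfg
    obtain ⟨x, y, f, rfl⟩ := Arrow.mk_surjective f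
    obtain ⟨x', y', g, rfl⟩ := Arrow.mk_surjective g
    obtain rfl : x = x' := h₁
    obtain rfl : y = y' := h₂
    rw [Subsingleton.elim f g]
  · rintro _ ⟨α, rfl⟩ _ ⟨β, rfl⟩
    obtain ⟨γ, hγ⟩ := h α β
    exact ⟨_, ⟨γ, rfl⟩, hγ⟩

end

end

/-! ### Lifting the comultiplication, and the comonoid laws, to finite stages. -/

section

open ComonObj

section

variable {M : Type u} [Category.{v} M] {κ : Cardinal.{w}} [Fact κ.IsRegular]
  {J : Type w} [PartialOrder J] {F : J ⥤ M} {C : M}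

/-- The cocone on a functor from a poset with given components. -/
def coconeOfPoset (s : ∀ j, F.obj j ⟶ C)
    (hs : ∀ ⦃j k : J⦄ (h : j ≤ k), F.map (homOfLE h) ≫ s k = s j) : Cocone F where
  pt := C
  ι.app := s
  ι.naturality _ _ f := (hs (leOfHom f)).trans (Category.comp_id _).symm

variable [IsCardinalFiltered J κ] {s : ∀ j, F.obj j ⟶ C}
  {hs : ∀ ⦃j k : J⦄ (h : j ≤ k), F.map (homOfLE h) ≫ s k = s j}

section

variable {N : Type*} [Category* N]

lemma exists_lift_of_isCardinalAccessible (hc : IsColimit (coconeOfPoset s hs)) (T : M ⥤ N)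
    [T.IsCardinalAccessible κ] {Y : N} [IsCardinalPresentable Y κ] (f : Y ⟶ T.obj C) (j : J) :
    ∃ (k : J) (_ : j ≤ k) (g : Y ⟶ T.obj (F.obj k)), g ≫ T.map (s k) = f := by
  have := T.preservesColimitsOfShape_of_isCardinalAccessible κ J
  obtain ⟨k, g, hg⟩ := IsCardinalPresentable.exists_hom_of_isColimit κ
    (isColimitOfPreserves T hc) f
  obtain ⟨l, h₁, h₂⟩ := exists_le_le_of_isCardinalFiltered κ j k
  refine ⟨l, h₁, g ≫ T.map (F.map (homOfLE h₂)), ?_⟩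
  rw [Category.assoc, ← T.map_comp, hs]
  exact hg

lemma exists_map_eq_of_isCardinalAccessible (hc : IsColimit (coconeOfPoset s hs)) (T : M ⥤ N)
    [T.IsCardinalAccessible κ] {Y : N} [IsCardinalPresentable Y κ] {j k : J}
    (f : Y ⟶ T.obj (F.obj j)) (g : Y ⟶ T.obj (F.obj k))
    (h : f ≫ T.map (s j) = g ≫ T.map (s k)) :
    ∃ (l : J) (h₁ : j ≤ l) (h₂ : k ≤ l),
      f ≫ T.map (F.map (homOfLE h₁)) = g ≫ T.map (F.map (homOfLE h₂)) := by
  have := T.preservesColimitsOfShape_of_isCardinalAccessible κ J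
  obtain ⟨l, a, b, h⟩ := IsCardinalPresentable.exists_eq_of_isColimit κ
    (isColimitOfPreserves T hc) f g h
  exact ⟨l, leOfHom a, leOfHom b, h⟩

end

end

variable {M : Type u} [Category.{v} M] [MonoidalCategory M] {κ : Cardinal.{w}} [Fact κ.IsRegular]
  [(tensor M).IsCardinalAccessible κ] {J : Type w} [PartialOrder J] [IsCardinalFiltered J κ]
  {F : J ⥤ M} {C : M} {s : ∀ j, F.obj j ⟶ C}
  {hs : ∀ ⦃j k : J⦄ (h : j ≤ k), F.map (homOfLE h) ≫ s k = s j}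

lemma exists_map_tensorHom_eq (hc : IsColimit (coconeOfPoset s hs)) {Y : M}
    [IsCardinalPresentable Y κ] {j k : J} (f : Y ⟶ F.obj j ⊗ F.obj j) (g : Y ⟶ F.obj k ⊗ F.obj k)
    (h : f ≫ (s j ⊗ₘ s j) = g ≫ (s k ⊗ₘ s k)) :
    ∃ (l : J) (h₁ : j ≤ l) (h₂ : k ≤ l),
      f ≫ (F.map (homOfLE h₁) ⊗ₘ F.map (homOfLE h₁)) =
        g ≫ (F.map (homOfLE h₂) ⊗ₘ F.map (homOfLE h₂)) :=
  exists_map_eq_of_isCardinalAccessible (κ := κ) hc (tensorSquare M) f g h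

lemma exists_map_tensorHom_tensorHom_eq (hc : IsColimit (coconeOfPoset s hs)) {Y : M}
    [IsCardinalPresentable Y κ] {j : J} (f g : Y ⟶ F.obj j ⊗ F.obj j ⊗ F.obj j)
    (h : f ≫ (s j ⊗ₘ s j ⊗ₘ s j) = g ≫ (s j ⊗ₘ s j ⊗ₘ s j)) :
    ∃ (k : J) (h : j ≤ k),
      f ≫ (F.map (homOfLE h) ⊗ₘ F.map (homOfLE h) ⊗ₘ F.map (homOfLE h)) =
        g ≫ (F.map (homOfLE h) ⊗ₘ F.map (homOfLE h) ⊗ₘ F.map (homOfLE h)) := by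
  obtain ⟨k, h, _, eq⟩ :=
    exists_map_eq_of_isCardinalAccessible (κ := κ) hc (tensorCube M) f g h
  exact ⟨k, h, eq⟩

omit [MonoidalCategory M] [(tensor M).IsCardinalAccessible κ] in
lemma exists_map_eq_of_isCardinalPresentable (hc : IsColimit (coconeOfPoset s hs)) {Y : M}
    [IsCardinalPresentable Y κ] {j k : J} (f : Y ⟶ F.obj j) (g : Y ⟶ F.obj k)
    (h : f ≫ s j = g ≫ s k) :
    ∃ (l : J) (h₁ : j ≤ l) (h₂ : k ≤ l),
      f ≫ F.map (homOfLE h₁) = g ≫ F.map (homOfLE h₂) :=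
  exists_map_eq_of_isCardinalAccessible (κ := κ) hc (𝟭 M) f g h

variable [ComonObj C] {j k : J} [IsCardinalPresentable (F.obj j) κ]
  {δ : F.obj j ⟶ F.obj k ⊗ F.obj k}

include κ

-- The counit itself is never lifted: one tensor factor goes to the unit through `s k ≫ ε`, so the
-- law becomes an equality of maps into a single `F l`, where presentability of `F j` applies
-- directly.
omit [(tensor M).IsCardinalAccessible κ] in
lemma exists_comul_lift_counit_left (hc : IsColimit (coconeOfPoset s hs))
    (hδ : δ ≫ (s k ⊗ₘ s k) = s j ≫ Δ) :
    ∃ (l : J) (h₀ : j ≤ l) (h : k ≤ l),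
      δ ≫ ((s k ≫ ε) ⊗ₘ F.map (homOfLE h)) = F.map (homOfLE h₀) ≫ (λ_ _).inv := by
  have e : (s k ≫ ε) ▷ F.obj k ≫ (λ_ _).hom ≫ s k = (s k ⊗ₘ s k) ≫ ε ▷ C ≫ (λ_ C).hom := by
    rw [← leftUnitor_naturality, MonoidalCategory.tensorHom_def, comp_whiskerRight_assoc,
      Category.assoc, whisker_exchange_assoc]
  obtain ⟨l, h, h₀, eq⟩ := exists_map_eq_of_isCardinalPresentable (κ := κ) hc
    (δ ≫ ((s k ≫ ε) ▷ F.obj k) ≫ (λ_ _).hom) (𝟙 (F.obj j)) (by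
      rw [Category.assoc, Category.assoc, e, reassoc_of% hδ, counit_comul_assoc, Iso.inv_hom_id,
        Category.comp_id, Category.id_comp])
  refine ⟨l, h₀, h, ?_⟩
  rw [← cancel_mono (λ_ _).hom, MonoidalCategory.tensorHom_def]
  simpa using eq

omit [(tensor M).IsCardinalAccessible κ] in
lemma exists_comul_lift_counit_right (hc : IsColimit (coconeOfPoset s hs))
    (hδ : δ ≫ (s k ⊗ₘ s k) = s j ≫ Δ) :
    ∃ (l : J) (h₀ : j ≤ l) (h : k ≤ l),
      δ ≫ (F.map (homOfLE h) ⊗ₘ (s k ≫ ε)) = F.map (homOfLE h₀) ≫ (ρ_ _).inv := by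
  have e : F.obj k ◁ (s k ≫ ε) ≫ (ρ_ _).hom ≫ s k = (s k ⊗ₘ s k) ≫ C ◁ ε ≫ (ρ_ C).hom := by
    rw [← rightUnitor_naturality, MonoidalCategory.tensorHom_def', whiskerLeft_comp_assoc,
      Category.assoc, ← whisker_exchange_assoc]
  obtain ⟨l, h, h₀, eq⟩ := exists_map_eq_of_isCardinalPresentable (κ := κ) hc
    (δ ≫ (F.obj k ◁ (s k ≫ ε)) ≫ (ρ_ _).hom) (𝟙 (F.obj j)) (by
      rw [Category.assoc, Category.assoc, e, reassoc_of% hδ, comul_counit_assoc, Iso.inv_hom_id,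
        Category.comp_id, Category.id_comp])
  refine ⟨l, h₀, h, ?_⟩
  rw [← cancel_mono (ρ_ _).hom, MonoidalCategory.tensorHom_def']
  simpa using eq

lemma exists_comul_lift_compatible (hc : IsColimit (coconeOfPoset s hs)) {j' k' : J}
    {δ' : F.obj j' ⟶ F.obj k' ⊗ F.obj k'}
    (hδ : δ ≫ (s k ⊗ₘ s k) = s j ≫ Δ)
    (hδ' : δ' ≫ (s k' ⊗ₘ s k') = s j' ≫ Δ) (h : j ≤ j') :
    ∃ (l : J) (h₁ : k ≤ l) (h₂ : k' ≤ l),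
      F.map (homOfLE h) ≫ δ' ≫ (F.map (homOfLE h₂) ⊗ₘ F.map (homOfLE h₂)) =
        δ ≫ (F.map (homOfLE h₁) ⊗ₘ F.map (homOfLE h₁)) := by
  obtain ⟨l, h₁, h₂, eq⟩ := exists_map_tensorHom_eq (κ := κ) hc
    (F.map (homOfLE h) ≫ δ') δ (by rw [Category.assoc, hδ, hδ', reassoc_of% hs])
  exact ⟨l, h₂, h₁, by simpa using eq⟩

/-- Both composites agree in the triple tensor power of `C`, hence at a later stage, since the
tensor cube is accessible. The second lift starts at any `k₁` above `k`, because `k` itself may lie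
outside the chain used later. -/
lemma exists_comul_lift_assoc (hc : IsColimit (coconeOfPoset s hs)) {k₁ k₂ : J}
    {δ' : F.obj k₁ ⟶ F.obj k₂ ⊗ F.obj k₂}
    (hδ : δ ≫ (s k ⊗ₘ s k) = s j ≫ Δ)
    (hδ' : δ' ≫ (s k₂ ⊗ₘ s k₂) = s k₁ ≫ Δ) (h : k ≤ k₁) :
    ∃ (l : J) (h₁ : k ≤ l) (h₂ : k₂ ≤ l),
      δ ≫ (F.map (homOfLE h₁) ⊗ₘ
        (F.map (homOfLE h) ≫ δ' ≫ (F.map (homOfLE h₂) ⊗ₘ F.map (homOfLE h₂)))) =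
      δ ≫ ((F.map (homOfLE h) ≫ δ' ≫ (F.map (homOfLE h₂) ⊗ₘ F.map (homOfLE h₂))) ⊗ₘ
        F.map (homOfLE h₁)) ≫ (α_ _ _ _).hom := by
  obtain ⟨m, h₁, h₂⟩ := exists_le_le_of_isCardinalFiltered κ k k₂
  obtain ⟨g, hg'⟩ : ∃ g, g = F.map (homOfLE h) ≫ δ' ≫
    (F.map (homOfLE h₂) ⊗ₘ F.map (homOfLE h₂)) := ⟨_, rfl⟩
  have hg : g ≫ (s m ⊗ₘ s m) = s k ≫ Δ := by
    simp only [hg', Category.assoc, tensorHom_comp_tensorHom, hs, hδ', reassoc_of% hs]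
  obtain ⟨l, a, eq⟩ := exists_map_tensorHom_tensorHom_eq (κ := κ) hc
    (δ ≫ (F.map (homOfLE h₁) ⊗ₘ g)) (δ ≫ (g ⊗ₘ F.map (homOfLE h₁)) ≫ (α_ _ _ _).hom) (by
      have e₁ : s k ⊗ₘ (s k ≫ Δ) = (s k ⊗ₘ s k) ≫ C ◁ Δ := by
        rw [← id_tensorHom, tensorHom_comp_tensorHom, Category.comp_id]
      have e₂ : (s k ≫ Δ) ⊗ₘ s k = (s k ⊗ₘ s k) ≫ Δ ▷ C := by
        rw [← tensorHom_id, tensorHom_comp_tensorHom, Category.comp_id]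
      simp only [Category.assoc, ← associator_naturality,
        tensorHom_comp_tensorHom_assoc, tensorHom_comp_tensorHom, hg, hs]
      rw [e₁, e₂, Category.assoc, reassoc_of% hδ, reassoc_of% hδ, comul_assoc])
  refine ⟨l, h₁.trans a, h₂.trans a, ?_⟩
  have h₁a : F.map (homOfLE (h₁.trans a)) = F.map (homOfLE h₁) ≫ F.map (homOfLE a) := by
    rw [← F.map_comp, homOfLE_comp]
  have h₂a : F.map (homOfLE (h₂.trans a)) = F.map (homOfLE h₂) ≫ F.map (homOfLE a) := by
    rw [← F.map_comp, homOfLE_comp]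
  simp only [Category.assoc, ← associator_naturality, hg',
    tensorHom_comp_tensorHom_assoc, tensorHom_comp_tensorHom] at eq
  simpa only [h₁a, h₂a, tensorHom_comp_tensorHom, Category.assoc] using eq

end

/-! ### Factorization through a comonoid with presentable underlying object. -/

section

open ComonObj

variable {M : Type u} [Category.{v} M] [MonoidalCategory M] {κ : Cardinal.{w}} [Fact κ.IsRegular]
  [(tensor M).IsCardinalAccessible κ] {J : Type w} [PartialOrder J] [IsCardinalFiltered J κ]
  {F : J ⥤ M} {C : M} {s : ∀ j, F.obj j ⟶ C}
  {hs : ∀ ⦃j k : J⦄ (h : j ≤ k), F.map (homOfLE h) ≫ s k = s j} [ComonObj C]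

/-- Each `f i` respects comultiplication once mapped to `C`, hence at some stage; fewer than `κ`
indices allow a common stage. -/
lemma exists_isComonHom_lift (hc : IsColimit (coconeOfPoset s hs)) {j₀ : J} {ι : Type*}
    (hι : HasCardinalLT ι κ) {Y : ι → M} [∀ i, ComonObj (Y i)] [∀ i, IsCardinalPresentable (Y i) κ]
    (f : ∀ i, Y i ⟶ F.obj j₀) [∀ i, IsComonHom (f i ≫ s j₀)] {j k : J} (h : j₀ ≤ j)
    {δ : F.obj j ⟶ F.obj k ⊗ F.obj k} (hδ : δ ≫ (s k ⊗ₘ s k) = s j ≫ Δ) :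
    ∃ (l : J) (h₁ : j₀ ≤ l) (h₂ : k ≤ l), ∀ i,
      f i ≫ F.map (homOfLE h) ≫ δ ≫ (F.map (homOfLE h₂) ⊗ₘ F.map (homOfLE h₂)) =
        Δ ≫ (f i ⊗ₘ f i) ≫ (F.map (homOfLE h₁) ⊗ₘ F.map (homOfLE h₁)) := by
  have (i : ι) := exists_map_tensorHom_eq (κ := κ) hc (f i ≫ F.map (homOfLE h) ≫ δ)
    (Δ ≫ (f i ⊗ₘ f i)) (by
      have := IsComonHom.hom_comul (f i ≫ s j₀)
      simp only [Category.assoc] at this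
      simp only [Category.assoc, hδ, reassoc_of% hs, this, tensorHom_comp_tensorHom])
  choose m h₂ h₁ eq using this
  obtain ⟨m', hm'⟩ := exists_forall_le_of_hasCardinalLT κ m hι
  obtain ⟨l₁, hl₁, hl₁'⟩ := exists_le_le_of_isCardinalFiltered κ j₀ k
  obtain ⟨l, hl, hl'⟩ := exists_le_le_of_isCardinalFiltered κ l₁ m'
  refine ⟨l, hl₁.trans hl, hl₁'.trans hl, fun i ↦ ?_⟩
  have e {a : J} (ha : a ≤ m i) : F.map (homOfLE (ha.trans ((hm' i).trans hl'))) =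
      F.map (homOfLE ha) ≫ F.map (homOfLE ((hm' i).trans hl')) := by
    rw [← F.map_comp, homOfLE_comp]
  have := eq i =≫ (F.map (homOfLE ((hm' i).trans hl')) ⊗ₘ F.map (homOfLE ((hm' i).trans hl')))
  rw [e (h₁ i), e (h₂ i)]
  simpa only [Category.assoc, ← tensorHom_comp_tensorHom] using this

/-- The core construction: `X` is the colimit of a chain closed under every stage needed for the
laws. The family `τ` is the identity for all comonoids and the braiding for cocommutative ones. -/
lemma exists_isComonHom_factorization [LocallySmall.{w} M]
    (hc : IsColimit (coconeOfPoset s hs)) [∀ j, IsCardinalPresentable (F.obj j) κ]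
    (τ : ∀ X : M, X ⊗ X ⟶ X ⊗ X)
    (hτ : ∀ {X Y : M} (f : X ⟶ Y), (f ⊗ₘ f) ≫ τ Y = τ X ≫ (f ⊗ₘ f)) (hC : Δ ≫ τ C = Δ)
    (Λ : Type w) [LinearOrder Λ] [WellFoundedLT Λ]
    [NoMaxOrder Λ] [Nonempty Λ] [HasColimitsOfShape Λ M] (hΛ : HasCardinalLT Λ κ)
    (j₀ : J) {ι : Type*} (hι : HasCardinalLT ι κ) (Y : ι → M) [∀ i, ComonObj (Y i)]
    [∀ i, IsCardinalPresentable (Y i) κ] (f : ∀ i, Y i ⟶ F.obj j₀)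
    [∀ i, IsComonHom (f i ≫ s j₀)] :
    ∃ (X : M) (_ : ComonObj X) (p : X ⟶ C) (q : F.obj j₀ ⟶ X),
      IsCardinalPresentable X κ ∧ Δ ≫ τ X = Δ ∧ IsComonHom p ∧ q ≫ p = s j₀ ∧
      ∀ i, IsComonHom (f i ≫ q) := by
  have hlift (j : J) : ∃ (k : J) (_ : j ≤ k) (δ : F.obj j ⟶ F.obj k ⊗ F.obj k),
      δ ≫ (s k ⊗ₘ s k) = s j ≫ Δ :=
    exists_lift_of_isCardinalAccessible (κ := κ) hc (tensorSquare M) (s j ≫ Δ) j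
  choose n hn δ hδ using hlift
  choose m₁ h₁ h₁' eq₁ using fun j k (h : j ≤ k) ↦
    exists_comul_lift_compatible (κ := κ) hc (hδ j) (hδ k) h
  choose m₂ h₂ h₂' eq₂ using fun j ↦ exists_comul_lift_counit_left (κ := κ) hc (hδ j)
  choose m₃ h₃ h₃' eq₃ using fun j ↦ exists_comul_lift_counit_right (κ := κ) hc (hδ j)
  choose m₄ h₄ h₄' eq₄ using fun j k (h : n j ≤ k) ↦
    exists_comul_lift_assoc (κ := κ) hc (hδ j) (hδ k) h
  choose m₅ h₅ h₅' eq₅ using fun j ↦ exists_map_tensorHom_eq (κ := κ) hc (δ j ≫ τ _) (δ j) (by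
    rw [Category.assoc, ← hτ, reassoc_of% hδ j, hC, hδ])
  choose m₆ h₆ h₆' eq₆ using fun j (h : j₀ ≤ j) ↦
    exists_isComonHom_lift (κ := κ) hc hι f h (hδ j)
  have hr (j k : J) : ∃ r, j ≤ r ∧ j₀ ≤ r ∧ n j ≤ r ∧ (∀ h, m₁ j k h ≤ r) ∧ m₂ j ≤ r ∧ m₃ j ≤ r ∧
      (∀ h, m₄ j k h ≤ r) ∧ m₅ j ≤ r ∧ (∀ h, m₆ j h ≤ r) := by
    -- Some stages depend on an inequality; indexing them by `PLift` of it keeps the family to be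
    -- bounded finite.
    obtain ⟨r, hr⟩ := exists_forall_le_of_hasCardinalLT κ
      (Sum.elim ![j, j₀, n j, m₂ j, m₃ j, m₅ j]
        (Sum.elim (fun h : PLift (j ≤ k) ↦ m₁ j k h.down)
          (Sum.elim (fun h : PLift (n j ≤ k) ↦ m₄ j k h.down)
            (fun h : PLift (j₀ ≤ j) ↦ m₆ j h.down))))
      (hasCardinalLT_of_finite _ _ (Cardinal.IsRegular.aleph0_le Fact.out))
    exact ⟨r, hr (.inl 0), hr (.inl 1), hr (.inl 2), fun h ↦ hr (.inr (.inl ⟨h⟩)), hr (.inl 3),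
      hr (.inl 4), fun h ↦ hr (.inr (.inr (.inl ⟨h⟩))), hr (.inl 5),
      fun h ↦ hr (.inr (.inr (.inr ⟨h⟩)))⟩
  choose r r₀ rj₀ rn r₁ r₂ r₃ r₄ r₅ r₆ using hr
  obtain ⟨S, D, ⟨a₀, ha₀⟩, hX, hS⟩ := exists_restrictedColimit (κ := κ) F Λ hΛ r r₀
  have mem {j k l : J} (hj : j ∈ S) (hk : k ∈ S) (h : l ≤ r j k) : l ∈ lowerClosure S :=
    (lowerClosure S).lower h (hS j hj k hk)
  have hLn {j : J} (hj : j ∈ S) : n j ∈ lowerClosure S := mem hj hj (rn j j)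
  have hLj₀ : j₀ ∈ lowerClosure S := mem ha₀ ha₀ (rj₀ _ _)
  obtain ⟨p, hp⟩ := D.exists_desc (fun j _ ↦ s j) (fun j _ k _ h ↦ hs h)
  replace hp (j : J) (hj : j ∈ lowerClosure S) : D.ι j hj ≫ p = s j := by
    obtain ⟨k, hk, h⟩ := id hj
    rw [← D.map_ι h (subset_lowerClosure hk), Category.assoc, hp _ hk, hs]
  have map_tensor_ι {j k : J} (h : j ≤ k) (hk : k ∈ lowerClosure S) :
      (F.map (homOfLE h) ⊗ₘ F.map (homOfLE h)) ≫ (D.ι k hk ⊗ₘ D.ι k hk) =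
        D.ι j ((lowerClosure S).lower h hk) ⊗ₘ D.ι j ((lowerClosure S).lower h hk) := by
    rw [tensorHom_comp_tensorHom, D.map_ι]
  -- The comultiplication is glued from the lifts `δ j`; `eq₁` gives their compatibility.
  obtain ⟨d, hd⟩ := D.exists_desc
    (fun j hj ↦ δ j ≫ (D.ι (n j) (hLn hj) ⊗ₘ D.ι (n j) (hLn hj))) (fun j hj k hk h ↦ by
      have hm := mem hj hk (r₁ j k h)
      rw [← map_tensor_ι (h₁ j k h) hm, ← map_tensor_ι (h₁' j k h) hm, reassoc_of% eq₁ j k h])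
  have hdp : p ≫ Δ = d ≫ (p ⊗ₘ p) := D.hom_ext fun j hj ↦ by
    rw [reassoc_of% hp, reassoc_of% hd _ hj, tensorHom_comp_tensorHom, hp, hδ]
  have counit_left : d ≫ (p ≫ ε) ▷ D.pt = (λ_ _).inv := D.hom_ext fun j hj ↦ by
    have hm := mem hj hj (r₂ j j)
    have := eq₂ j =≫ (𝟙_ M ◁ D.ι _ hm)
    rw [Category.assoc, Category.assoc, ← leftUnitor_inv_naturality, reassoc_of% D.map_ι,
      ← id_tensorHom, tensorHom_comp_tensorHom, Category.comp_id, D.map_ι] at this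
    rw [← this, reassoc_of% hd _ hj, ← tensorHom_id, tensorHom_comp_tensorHom, reassoc_of% hp,
      Category.comp_id]
  have counit_right : d ≫ D.pt ◁ (p ≫ ε) = (ρ_ _).inv := D.hom_ext fun j hj ↦ by
    have hm := mem hj hj (r₃ j j)
    have := eq₃ j =≫ (D.ι _ hm ▷ 𝟙_ M)
    rw [Category.assoc, Category.assoc, ← rightUnitor_inv_naturality, reassoc_of% D.map_ι,
      ← tensorHom_id, tensorHom_comp_tensorHom, Category.comp_id, D.map_ι] at this
    rw [← this, reassoc_of% hd _ hj, ← id_tensorHom, tensorHom_comp_tensorHom, reassoc_of% hp,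
      Category.comp_id]
  have assoc : d ≫ D.pt ◁ d = d ≫ d ▷ D.pt ≫ (α_ _ _ _).hom := D.hom_ext fun j hj ↦ by
    -- `n j` is only below the chain, so the second comultiplication is computed by the lift at some
    -- `k ∈ S` above it.
    obtain ⟨k, hk, h⟩ := id (hLn hj)
    have hm := mem hj hk (r₄ j k h)
    have hnd : D.ι (n j) (hLn hj) ≫ d = F.map (homOfLE h) ≫ δ k ≫
        (F.map (homOfLE (h₄' j k h)) ⊗ₘ F.map (homOfLE (h₄' j k h))) ≫
          (D.ι _ hm ⊗ₘ D.ι _ hm) := by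
      rw [map_tensor_ι, ← D.map_ι h (subset_lowerClosure hk), Category.assoc, hd k hk]
    have := eq₄ j k h =≫ (D.ι _ hm ⊗ₘ D.ι _ hm ⊗ₘ D.ι _ hm)
    simp only [Category.assoc, ← associator_naturality, tensorHom_comp_tensorHom,
      tensorHom_comp_tensorHom_assoc, D.map_ι] at this
    rw [reassoc_of% hd _ hj, reassoc_of% hd _ hj, ← id_tensorHom, ← tensorHom_id,
      tensorHom_comp_tensorHom, tensorHom_comp_tensorHom_assoc, Category.comp_id, hnd,
      map_tensor_ι]
    exact this
  have hdτ : d ≫ τ D.pt = d := D.hom_ext fun j hj ↦ by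
    have hm := mem hj hj (r₅ j j)
    have := eq₅ j =≫ (D.ι _ hm ⊗ₘ D.ι _ hm)
    simp only [Category.assoc, map_tensor_ι] at this
    rw [reassoc_of% hd _ hj, hd _ hj, hτ, this]
  let _ : ComonObj D.pt :=
    { counit := p ≫ ε
      comul := d
      counit_comul := counit_left
      comul_counit := counit_right
      comul_assoc := assoc }
  refine ⟨D.pt, inferInstance, p, D.ι j₀ hLj₀, hX, hdτ, ⟨rfl, hdp⟩, hp _ _, fun i ↦ ⟨?_, ?_⟩⟩
  · change (f i ≫ D.ι j₀ hLj₀) ≫ p ≫ ε = ε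
    rw [Category.assoc, reassoc_of% hp, ← Category.assoc, IsComonHom.hom_counit]
  · change (f i ≫ D.ι j₀ hLj₀) ≫ d = _
    obtain ⟨k, hk, h⟩ := id hLj₀
    have hm := mem hk hk (r₆ k k h)
    have := eq₆ k h i =≫ (D.ι _ hm ⊗ₘ D.ι _ hm)
    simp only [Category.assoc, map_tensor_ι] at this
    rw [← D.map_ι h (subset_lowerClosure hk), Category.assoc, Category.assoc, hd k hk, this,
      D.map_ι, tensorHom_comp_tensorHom]

end

/-! ### Filtered colimits and presentability of comonoids. -/

section

open ComonObj

variable {M : Type u} [Category.{v} M] [MonoidalCategory M]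

section

variable {J : Type*} [Category* J]

/-- A cocone of comonoids is a colimit if its image under the forgetful functor is. -/
noncomputable def isColimitOfForgetComon {G : J ⥤ Comon M} {c : Cocone G}
    (hc : IsColimit ((Comon.forget M).mapCocone c)) : IsColimit c where
  desc t :=
    { hom := hc.desc ((Comon.forget M).mapCocone t)
      isComonHom_hom := by
        let i (j : J) : (G.obj j).X ⟶ c.pt.X := (c.ι.app j).hom
        let i' (j : J) : (G.obj j).X ⟶ t.pt.X := (t.ι.app j).hom
        have hi (j : J) : IsComonHom (i j) := inferInstanceAs (IsComonHom (c.ι.app j).hom)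
        have hi' (j : J) : IsComonHom (i' j) := inferInstanceAs (IsComonHom (t.ι.app j).hom)
        have hom_ext {Z : M} {f g : c.pt.X ⟶ Z} (h : ∀ j, i j ≫ f = i j ≫ g) : f = g :=
          hc.hom_ext h
        obtain ⟨d, hd⟩ : ∃ d : c.pt.X ⟶ t.pt.X, d = hc.desc ((Comon.forget M).mapCocone t) :=
          ⟨_, rfl⟩
        have fac (j : J) : i j ≫ d = i' j := hd ▸ hc.fac _ j
        rw [← hd]
        exact
        { hom_counit := hom_ext fun j ↦ by
            rw [reassoc_of% fac, IsComonHom.hom_counit, IsComonHom.hom_counit]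
          hom_comul := hom_ext fun j ↦ by
            rw [reassoc_of% fac, IsComonHom.hom_comul, IsComonHom.hom_comul_assoc,
              tensorHom_comp_tensorHom, fac] } }
  fac t j := Comon.ext (hc.fac ((Comon.forget M).mapCocone t) j)
  uniq t m hm := Comon.ext (hc.uniq ((Comon.forget M).mapCocone t) m.hom
    fun j ↦ congrArg Comon.Hom.hom (hm j))

/-- Counit and comultiplication are maps out of the colimit, so they descend from the diagram and
the laws are checked on each leg. -/
lemma exists_cocone_forgetComon (G : J ⥤ Comon M) {c : Cocone (G ⋙ Comon.forget M)}
    (hc : IsColimit c) [PreservesColimit (G ⋙ Comon.forget M) (tensorSquare M)] :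
    ∃ c' : Cocone G, Nonempty ((Comon.forget M).mapCocone c' ≅ c) := by
  let i (j : J) : (G.obj j).X ⟶ c.pt := c.ι.app j
  have hi {j k : J} (f : j ⟶ k) : (G.map f).hom ≫ i k = i j := c.w f
  have hom_ext {Z : M} {f g : c.pt ⟶ Z} (h : ∀ j, i j ≫ f = i j ≫ g) : f = g := hc.hom_ext h
  obtain ⟨e, he⟩ : ∃ e : c.pt ⟶ 𝟙_ M, ∀ j, i j ≫ e = ε :=
    ⟨hc.desc { pt := 𝟙_ M
               ι.app j := (ε : (G.obj j).X ⟶ 𝟙_ M)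
               ι.naturality j k f :=
                 (IsComonHom.hom_counit (G.map f).hom).trans (Category.comp_id _).symm },
      fun j ↦ hc.fac _ j⟩
  obtain ⟨d, hd⟩ : ∃ d : c.pt ⟶ c.pt ⊗ c.pt, ∀ j, i j ≫ d = Δ ≫ (i j ⊗ₘ i j) :=
    ⟨hc.desc { pt := c.pt ⊗ c.pt
               ι.app j := (Δ : (G.obj j).X ⟶ _) ≫ (i j ⊗ₘ i j)
               ι.naturality j k f := by
                 refine Eq.trans ?_ (Category.comp_id _).symm
                 change (G.map f).hom ≫ Δ ≫ (i k ⊗ₘ i k) = _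
                 rw [IsComonHom.hom_comul_assoc, tensorHom_comp_tensorHom, hi]
                 rfl },
      fun j ↦ hc.fac _ j⟩
  let _ : ComonObj c.pt :=
    { counit := e
      comul := d
      counit_comul := hom_ext fun j ↦ by
        rw [reassoc_of% hd, ← tensorHom_id, tensorHom_comp_tensorHom, he, Category.comp_id,
          counit_comul_hom]
      comul_counit := hom_ext fun j ↦ by
        rw [reassoc_of% hd, ← id_tensorHom, tensorHom_comp_tensorHom, he, Category.comp_id,
          comul_counit_hom]
      comul_assoc := hom_ext fun j ↦ by
        have e₁ : i j ⊗ₘ (Δ ≫ (i j ⊗ₘ i j)) = (G.obj j).X ◁ Δ ≫ (i j ⊗ₘ i j ⊗ₘ i j) := by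
          rw [← id_tensorHom, tensorHom_comp_tensorHom, Category.id_comp]
        have e₂ : (Δ ≫ (i j ⊗ₘ i j)) ⊗ₘ i j = Δ ▷ (G.obj j).X ≫ ((i j ⊗ₘ i j) ⊗ₘ i j) := by
          rw [← tensorHom_id, tensorHom_comp_tensorHom, Category.id_comp]
        rw [reassoc_of% hd, reassoc_of% hd, ← id_tensorHom, ← tensorHom_id,
          tensorHom_comp_tensorHom, tensorHom_comp_tensorHom_assoc, Category.comp_id, hd, e₁, e₂,
          Category.assoc, associator_naturality, comul_assoc_assoc] }
  exact ⟨{ pt := ⟨c.pt⟩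
           ι.app j := { hom := i j, isComonHom_hom := ⟨he j, hd j⟩ }
           ι.naturality j k f := Comon.ext (c.ι.naturality f) },
    ⟨Cocone.ext (Iso.refl _) fun j ↦ Category.comp_id _⟩⟩

lemma comul_comp_eq_of_isColimit {G : J ⥤ Comon M} {c : Cocone G}
    (hc : IsColimit ((Comon.forget M).mapCocone c)) {τ : ∀ X : M, X ⊗ X ⟶ X ⊗ X}
    (hτ : ∀ {X Y : M} (f : X ⟶ Y), (f ⊗ₘ f) ≫ τ Y = τ X ≫ (f ⊗ₘ f))
    (hG : ∀ j, Δ[(G.obj j).X] ≫ τ (G.obj j).X = Δ) : Δ[c.pt.X] ≫ τ c.pt.X = Δ :=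
  hc.hom_ext fun j ↦ by
    let i : (G.obj j).X ⟶ c.pt.X := (c.ι.app j).hom
    have hi : IsComonHom i := inferInstanceAs (IsComonHom (c.ι.app j).hom)
    change i ≫ Δ ≫ _ = i ≫ Δ
    rw [IsComonHom.hom_comul_assoc, hτ, reassoc_of% hG j, IsComonHom.hom_comul]

end

section

variable {K : Type u'} [Category.{v'} K] (V : K ⥤ Comon M) [V.Full] [V.Faithful]
  {τ : ∀ X : M, X ⊗ X ⟶ X ⊗ X}
  (hτ : ∀ {X Y : M} (f : X ⟶ Y), (f ⊗ₘ f) ≫ τ Y = τ X ≫ (f ⊗ₘ f))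
  (hV : ∀ X : Comon M, V.essImage X ↔ Δ[X.X] ≫ τ X.X = Δ)
  (κ : Cardinal.{w}) [Fact κ.IsRegular] [(tensor M).IsCardinalAccessible κ]
  [HasCardinalFilteredColimits M κ]

include hτ hV

/-- The condition `Δ ≫ τ = Δ` passes to colimits of comonoids, so the essential image of `V` is
closed under them and `V` creates them. -/
lemma hasColimitsOfShape_and_preservesColimitsOfShape_of_essImage_comon
    (J : Type w) [SmallCategory J] [IsCardinalFiltered J κ] :
    HasColimitsOfShape J K ∧ PreservesColimitsOfShape J (V ⋙ Comon.forget M) := by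
  have := HasCardinalFilteredColimits.hasColimitsOfShape M κ J
  have := (tensorSquare M).preservesColimitsOfShape_of_isCardinalAccessible κ J
  have key (G : J ⥤ K) : HasColimit G ∧ PreservesColimit G (V ⋙ Comon.forget M) := by
    obtain ⟨c, ⟨e⟩⟩ := exists_cocone_forgetComon (G ⋙ V)
      (colimit.isColimit ((G ⋙ V) ⋙ Comon.forget M))
    have hc : IsColimit ((Comon.forget M).mapCocone c) :=
      (colimit.isColimit _).ofIsoColimit e.symm
    have hc' := isColimitOfForgetComon hc
    obtain ⟨X, ⟨i⟩⟩ := (hV c.pt).2 (comul_comp_eq_of_isColimit hc hτ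
      fun j ↦ (hV _).1 (V.obj_mem_essImage (G.obj j)))
    have := createsColimitOfFullyFaithfulOfIso' hc' X i
    have : HasColimit (G ⋙ V) := ⟨_, hc'⟩
    have : PreservesColimit (G ⋙ V) (Comon.forget M) :=
      preservesColimit_of_preserves_colimit_cocone hc' hc
    exact ⟨hasColimit_of_created G V, inferInstance⟩
  exact ⟨⟨fun G ↦ (key G).1⟩, ⟨fun {G} ↦ (key G).2⟩⟩

lemma hasCardinalFilteredColimits_of_essImage_comon : HasCardinalFilteredColimits K κ where
  hasColimitsOfShape J _ _ :=
    (hasColimitsOfShape_and_preservesColimitsOfShape_of_essImage_comon V hτ hV κ J).1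

lemma isCardinalAccessible_of_essImage_comon : (V ⋙ Comon.forget M).IsCardinalAccessible κ where
  preservesColimitOfShape J _ _ :=
    (hasColimitsOfShape_and_preservesColimitsOfShape_of_essImage_comon V hτ hV κ J).2

-- A comonoid morphism into the colimit factors in `M` through some stage; a later stage makes the
-- factorization respect comultiplication, again by presentability of the underlying object.
omit hτ hV [HasCardinalFilteredColimits M κ] in
lemma isCardinalPresentable_of_isCardinalPresentable_comon
    [(V ⋙ Comon.forget M).IsCardinalAccessible κ] (X : K)
    [IsCardinalPresentable (V.obj X).X κ] : IsCardinalPresentable X κ where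
  preservesColimitOfShape J _ _ := ⟨fun {G} ↦ ⟨fun {c} hc ↦ ⟨by
    have := isFiltered_of_isCardinalFiltered J κ
    have := (V ⋙ Comon.forget M).preservesColimitsOfShape_of_isCardinalAccessible κ J
    have := (tensorSquare M).preservesColimitsOfShape_of_isCardinalAccessible κ J
    have hc₁ := isColimitOfPreserves (V ⋙ Comon.forget M) hc
    have hc₂ := isColimitOfPreserves (tensorSquare M) hc₁
    refine Types.FilteredColimit.isColimitOf' _ _ (fun (f : X ⟶ c.pt) ↦ ?_)
      (fun j (f : X ⟶ G.obj j) (g : X ⟶ G.obj j) (h : f ≫ c.ι.app j = g ≫ c.ι.app j) ↦ ?_)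
    · obtain ⟨j, g, hg⟩ := IsCardinalPresentable.exists_hom_of_isColimit κ hc₁ (V.map f).hom
      change (V.obj X).X ⟶ (V.obj (G.obj j)).X at g
      change g ≫ (V.map (c.ι.app j)).hom = (V.map f).hom at hg
      obtain ⟨k, a, ha⟩ := IsCardinalPresentable.exists_eq_of_isColimit' κ hc₂ (g ≫ Δ)
        (Δ ≫ (g ⊗ₘ g)) (by
          change (g ≫ Δ) ≫ ((V.map (c.ι.app j)).hom ⊗ₘ (V.map (c.ι.app j)).hom) =
            (Δ ≫ (g ⊗ₘ g)) ≫ ((V.map (c.ι.app j)).hom ⊗ₘ (V.map (c.ι.app j)).hom)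
          rw [Category.assoc, Category.assoc, tensorHom_comp_tensorHom, hg,
            ← IsComonHom.hom_comul (V.map (c.ι.app j)).hom, reassoc_of% hg,
            IsComonHom.hom_comul])
      change (g ≫ Δ) ≫ ((V.map (G.map a)).hom ⊗ₘ (V.map (G.map a)).hom) =
        (Δ ≫ (g ⊗ₘ g)) ≫ ((V.map (G.map a)).hom ⊗ₘ (V.map (G.map a)).hom) at ha
      let g' : V.obj X ⟶ V.obj (G.obj k) := Comon.Hom.mk' (g ≫ (V.map (G.map a)).hom)
        (by
          -- No further stage is needed for the counit: the legs of the cocone preserve it.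
          rw [Category.assoc, IsComonHom.hom_counit, ← IsComonHom.hom_counit (V.map f).hom, ← hg,
            Category.assoc, IsComonHom.hom_counit (V.map (c.ι.app j)).hom])
        (by
          rw [Category.assoc, IsComonHom.hom_comul, ← Category.assoc, ha, Category.assoc,
            tensorHom_comp_tensorHom])
      refine ⟨k, V.preimage g', V.map_injective (Comon.ext ?_)⟩
      change _ = (V.map (V.preimage g' ≫ c.ι.app k)).hom
      rw [V.map_comp, V.map_preimage, Comon.comp_hom']
      change _ = (g ≫ (V.map (G.map a)).hom) ≫ _
      rw [Category.assoc, ← Comon.comp_hom', ← V.map_comp, c.w, hg]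
    · obtain ⟨k, a, ha⟩ := IsCardinalPresentable.exists_eq_of_isColimit' κ hc₁ (V.map f).hom
        (V.map g).hom (by
          change (V.map f).hom ≫ (V.map (c.ι.app j)).hom =
            (V.map g).hom ≫ (V.map (c.ι.app j)).hom
          rw [← Comon.comp_hom', ← Comon.comp_hom', ← V.map_comp, ← V.map_comp, h])
      refine ⟨k, a, V.map_injective (Comon.ext ?_)⟩
      change (V.map (f ≫ _)).hom = (V.map (g ≫ _)).hom
      rw [V.map_comp, V.map_comp]
      exact ha⟩⟩⟩

end

end

/-! ### Canonical diagrams, density and accessibility. -/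

section

open ComonObj

variable {M : Type u} [Category.{v} M] [MonoidalCategory M]
  {K : Type u'} [Category.{v'} K] (V : K ⥤ Comon M)
  (κ : Cardinal.{w}) [Fact κ.IsRegular]

/-- The objects whose underlying object is `κ`-presentable. -/
abbrev isCardinalPresentableUnderlying : ObjectProperty K :=
  (isCardinalPresentable M κ).inverseImage (V ⋙ Comon.forget M)

section

variable [V.Full] [V.Faithful]

/-- Comonoid structures on `Y` are determined by a pair in `(Y ⟶ 𝟙_ M) × (Y ⟶ Y ⊗ Y)`, a `w`-small
set. -/
lemma essentiallySmall_nonempty_iso_underlying [LocallySmall.{w} M] (Y : M) :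
    ObjectProperty.EssentiallySmall.{w}
      (fun A : K ↦ Nonempty ((V ⋙ Comon.forget M).obj A ≅ Y)) := by
  let P : ObjectProperty K := fun A ↦ Nonempty ((V ⋙ Comon.forget M).obj A ≅ Y)
  let i (A : Subtype P) : (V.obj A.1).X ≅ Y := A.2.some
  let φ (A : Subtype P) : (Y ⟶ 𝟙_ M) × (Y ⟶ Y ⊗ Y) :=
    ((i A).inv ≫ ε, (i A).inv ≫ Δ ≫ ((i A).hom ⊗ₘ (i A).hom))
  refine ⟨.ofObj (fun t : Set.range φ ↦ t.2.choose.1), inferInstance, fun A hA ↦ ?_⟩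
  let t : Set.range φ := ⟨φ ⟨A, hA⟩, ⟨_, rfl⟩⟩
  have ht : φ t.2.choose = φ ⟨A, hA⟩ := t.2.choose_spec
  refine ⟨_, ⟨t⟩, ⟨V.preimageIso ?_⟩⟩
  generalize t.2.choose = B at ht ⊢
  obtain ⟨h₁, h₂⟩ := Prod.mk.inj ht
  refine Comon.mkIso (i ⟨A, hA⟩ ≪≫ (i B).symm) ?_ ?_
  · simp only [Iso.trans_hom, Iso.symm_hom, Category.assoc, h₁, Iso.hom_inv_id_assoc]
  · have := (i ⟨A, hA⟩).hom ≫= h₂ =≫ ((i B).inv ⊗ₘ (i B).inv)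
    simpa only [Iso.trans_hom, Iso.symm_hom, Category.assoc, tensorHom_comp_tensorHom,
      Iso.hom_inv_id, Iso.hom_inv_id_assoc, id_tensorHom_id, Category.comp_id] using this

instance [LocallySmall.{w} M] [ObjectProperty.EssentiallySmall.{w} (isCardinalPresentable M κ)] :
    ObjectProperty.EssentiallySmall.{w} (isCardinalPresentableUnderlying V κ) :=
  .of_functor _ (V ⋙ Comon.forget M)
    (.of_le (Q := isCardinalPresentable M κ) (by
      rintro _ ⟨A, hA, ⟨e⟩⟩
      exact (isCardinalPresentable M κ).prop_of_iso e hA))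
    (fun Y ↦ have := essentiallySmall_nonempty_iso_underlying.{w} V Y
      .of_le inf_le_right)

end

/-- The functor sending an object with `κ`-presentable underlying object over `X` to its underlying
object over the underlying object of `X`. -/
abbrev underlyingCostructuredArrow (X : K) :
    CostructuredArrow (isCardinalPresentableUnderlying V κ).ι X ⥤
      CostructuredArrow (isCardinalPresentable M κ).ι (V.obj X).X where
  obj e := CostructuredArrow.mk (Y := ⟨(V.obj e.left.obj).X, e.left.property⟩)
    (by exact (V.map e.hom).hom)
  map {e e'} f := CostructuredArrow.homMk (by exact ObjectProperty.homMk (V.map f.left.hom).hom) (by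
    change (V.map f.left.hom).hom ≫ (V.map e'.hom).hom = (V.map e.hom).hom
    rw [← Comon.comp_hom', ← V.map_comp]
    congr 2
    exact CostructuredArrow.w f)
  map_id e := by
    ext
    change (V.map (𝟙 e.left.obj)).hom = _
    simp
  map_comp f g := by
    ext
    change (V.map (f.left.hom ≫ g.left.hom)).hom = _
    simp

variable {V κ}

section

variable [V.Full] [V.Faithful] [IsCardinalAccessibleCategory M κ]
  [(tensor M).IsCardinalAccessible κ]
  {τ : ∀ X : M, X ⊗ X ⟶ X ⊗ X}
  (hτ : ∀ {X Y : M} (f : X ⟶ Y), (f ⊗ₘ f) ≫ τ Y = τ X ≫ (f ⊗ₘ f))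
  (hV : ∀ X : Comon M, V.essImage X ↔ Δ[X.X] ≫ τ X.X = Δ)
  (Λ : Type w) [LinearOrder Λ] [WellFoundedLT Λ]
  [NoMaxOrder Λ] [Nonempty Λ] [HasColimitsOfShape Λ M] (hΛ : HasCardinalLT Λ κ)

include hτ hV hΛ

lemma exists_costructuredArrow_factorization {X : K} {J : Type w} [PartialOrder J]
    [IsCardinalFiltered J κ] {F : J ⥤ M} [∀ j, IsCardinalPresentable (F.obj j) κ]
    {s : ∀ j, F.obj j ⟶ (V.obj X).X} {hs : ∀ ⦃j k : J⦄ (h : j ≤ k), F.map (homOfLE h) ≫ s k = s j}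
    (hc : IsColimit (coconeOfPoset s hs)) (j₀ : J) {ι : Type*} (hι : HasCardinalLT ι κ)
    (A : ι → CostructuredArrow (isCardinalPresentableUnderlying V κ).ι X)
    (f : ∀ i, (V.obj (A i).left.obj).X ⟶ F.obj j₀) (hf : ∀ i, f i ≫ s j₀ = (V.map (A i).hom).hom) :
    ∃ (B : CostructuredArrow (isCardinalPresentableUnderlying V κ).ι X)
      (q : F.obj j₀ ⟶ (V.obj B.left.obj).X) (g : ∀ i, A i ⟶ B),
      q ≫ (V.map B.hom).hom = s j₀ ∧ ∀ i, (V.map (g i).left.hom).hom = f i ≫ q := by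
  have (i : ι) : IsCardinalPresentable (V.obj (A i).left.obj).X κ := (A i).left.property
  have (i : ι) : IsComonHom (f i ≫ s j₀) :=
    hf i ▸ inferInstanceAs (IsComonHom (V.map (A i).hom).hom)
  obtain ⟨Y, _, p, q, hY, hYτ, _, hq, hfq⟩ := exists_isComonHom_factorization (κ := κ) hc τ hτ
    ((hV _).1 (V.obj_mem_essImage X)) Λ hΛ j₀ hι (fun i ↦ (V.obj (A i).left.obj).X) f
  obtain ⟨B, ⟨e⟩⟩ := (hV ⟨Y⟩).2 hYτ
  have hB : IsCardinalPresentable (V.obj B).X κ :=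
    (isCardinalPresentable M κ).prop_of_iso ((Comon.forget M).mapIso e.symm) hY
  let p' : B ⟶ X := V.preimage (e.hom ≫ { hom := p })
  let g (i : ι) : (A i).left.obj ⟶ B := V.preimage ({ hom := f i ≫ q } ≫ e.inv)
  have he : e.inv.hom ≫ e.hom.hom = 𝟙 Y := congrArg Comon.Hom.hom e.inv_hom_id
  let B' : CostructuredArrow (isCardinalPresentableUnderlying V κ).ι X :=
    CostructuredArrow.mk (Y := ⟨B, hB⟩) (by exact p')
  refine ⟨B', q ≫ e.inv.hom,
    fun i ↦ CostructuredArrow.homMk (ObjectProperty.homMk (g i)) ?_, ?_, fun i ↦ ?_⟩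
  · refine V.map_injective (Comon.ext ?_)
    change (V.map (g i ≫ p')).hom = (V.map (A i).hom).hom
    rw [V.map_comp, V.map_preimage, V.map_preimage]
    change ((f i ≫ q) ≫ e.inv.hom) ≫ e.hom.hom ≫ p = _
    rw [Category.assoc, reassoc_of% he, Category.assoc, hq, hf]
  · change (q ≫ e.inv.hom) ≫ (V.map p').hom = _
    rw [V.map_preimage]
    change (q ≫ e.inv.hom) ≫ e.hom.hom ≫ p = _
    rw [Category.assoc, reassoc_of% he, hq]
  · change (V.map (g i)).hom = _
    rw [V.map_preimage]
    exact Category.assoc _ _ _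

omit [V.Full] [V.Faithful] [MonoidalCategory M] [(tensor M).IsCardinalAccessible κ] hτ hV hΛ in
variable (κ) in
lemma exists_isColimit_coconeOfPoset (X : M) :
    ∃ (J : Type w) (_ : PartialOrder J) (_ : IsCardinalFiltered J κ) (F : J ⥤ M)
      (s : ∀ j, F.obj j ⟶ X) (hs : ∀ ⦃j k : J⦄ (h : j ≤ k), F.map (homOfLE h) ≫ s k = s j),
      (∀ j, IsCardinalPresentable (F.obj j) κ) ∧ Nonempty (IsColimit (coconeOfPoset s hs)) := by
  obtain ⟨I, _, _, ⟨p⟩⟩ :=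
    (isCardinalFilteredGenerator_isCardinalPresentable M κ).exists_colimitsOfShape X
  obtain ⟨J, _, _, G, _⟩ := IsCardinalFiltered.exists_cardinal_directed I κ
  let p' := p.reindex G
  have hs ⦃j k : J⦄ (h : j ≤ k) : p'.diag.map (homOfLE h) ≫ p'.ι.app k = p'.ι.app j :=
    p'.cocone.w (homOfLE h)
  exact ⟨J, inferInstance, inferInstance, p'.diag, fun j ↦ p'.ι.app j, hs, p'.prop_diag_obj,
    ⟨p'.isColimit.ofIsoColimit (Cocone.ext (Iso.refl _) fun j ↦ Category.comp_id _)⟩⟩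

/-- Fewer than `κ` objects, or arrows, over `X` are first bounded, or equalized, at one stage `F j`
in `M`; the factorization then replaces that stage by an object of `K`. -/
lemma isCardinalFiltered_costructuredArrow_underlying (X : K) :
    IsCardinalFiltered (CostructuredArrow (isCardinalPresentableUnderlying V κ).ι X) κ := by
  have hκ : Cardinal.aleph0 ≤ κ := Cardinal.IsRegular.aleph0_le Fact.out
  obtain ⟨J, _, _, F, s, hs, _, ⟨hc⟩⟩ := exists_isColimit_coconeOfPoset κ (V.obj X).X
  have lift (A : CostructuredArrow (isCardinalPresentableUnderlying V κ).ι X) :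
      ∃ (j : J) (f : (V.obj A.left.obj).X ⟶ F.obj j), f ≫ s j = (V.map A.hom).hom := by
    have : IsCardinalPresentable (V.obj A.left.obj).X κ := A.left.property
    exact IsCardinalPresentable.exists_hom_of_isColimit (X := (V.obj A.left.obj).X) κ hc (V.map A.hom).hom
  rw [isCardinalFiltered_iff]
  refine ⟨fun ι A hι ↦ ?_, fun ι A B f hι ↦ ?_⟩
  · choose j f hf using fun i ↦ lift (A i)
    obtain ⟨j₀, hj₀⟩ := exists_forall_le_of_hasCardinalLT κ j hι
    obtain ⟨B, -, g, -⟩ := exists_costructuredArrow_factorization hτ hV Λ hΛ hc j₀ hι A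
      (fun i ↦ f i ≫ F.map (homOfLE (hj₀ i))) (fun i ↦ by rw [Category.assoc, hs, hf])
    exact ⟨B, fun i ↦ ⟨g i⟩⟩
  · have : IsCardinalPresentable (V.obj A.left.obj).X κ := A.left.property
    obtain ⟨j, a, ha⟩ := lift A
    obtain ⟨k, b, hb⟩ := lift B
    have w (i : ι) : (V.map (f i).left.hom).hom ≫ (V.map B.hom).hom = (V.map A.hom).hom := by
      rw [← Comon.comp_hom', ← V.map_comp]
      congr 2
      exact CostructuredArrow.w (f i)
    choose m h₁ h₂ h using fun i ↦ exists_map_eq_of_isCardinalPresentable (κ := κ) hc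
      ((V.map (f i).left.hom).hom ≫ b) a (by rw [Category.assoc, hb, w, ha])
    obtain ⟨m', hm'⟩ := exists_forall_le_of_hasCardinalLT κ m hι
    obtain ⟨l₁, hjl₁, hkl₁⟩ := exists_le_le_of_isCardinalFiltered κ j k
    obtain ⟨l, hl₁, hl⟩ := exists_le_le_of_isCardinalFiltered κ l₁ m'
    have hjl := hjl₁.trans hl₁
    have hkl := hkl₁.trans hl₁
    have hab (i : ι) : (V.map (f i).left.hom).hom ≫ b ≫ F.map (homOfLE hkl) =
        a ≫ F.map (homOfLE hjl) := by
      have := h i =≫ F.map (homOfLE ((hm' i).trans hl))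
      simpa only [Category.assoc, ← F.map_comp, homOfLE_comp] using this
    -- Applied to the pair `A`, `B`: the maps to stage `l` already identify every `f i` followed by
    -- that of `B` with that of `A`.
    obtain ⟨C, q, g, -, hg⟩ := exists_costructuredArrow_factorization hτ hV Λ hΛ hc l
      (ι := Bool) (hasCardinalLT_of_finite _ _ hκ) (fun i ↦ if i then A else B)
      (fun i ↦ match i with
        | true => a ≫ F.map (homOfLE hjl)
        | false => b ≫ F.map (homOfLE hkl))
      (fun i ↦ match i with
        | true => by
          rw [Category.assoc, hs]
          exact ha
        | false => by
          rw [Category.assoc, hs]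
          exact hb)
    refine ⟨C, g false, g true, fun i ↦ ?_⟩
    refine CostructuredArrow.hom_ext _ _ (ObjectProperty.hom_ext _
      (V.map_injective (Comon.ext ?_)))
    refine Eq.trans ?_ (hg true).symm
    change (V.map ((f i).left.hom ≫ (g false).left.hom)).hom = _
    rw [V.map_comp, Comon.comp_hom']
    refine ((V.map (f i).left.hom).hom ≫= hg false).trans ?_
    change _ ≫ (b ≫ _) ≫ q = (a ≫ _) ≫ q
    rw [← hab i]
    simp only [Category.assoc]

/-- Both finality conditions are the factorization, with no prescribed maps for existence and with
the single object `e` for equalizing a parallel pair. -/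
lemma final_underlyingCostructuredArrow (X : K) : (underlyingCostructuredArrow V κ X).Final := by
  have hκ : Cardinal.aleph0 ≤ κ := Cardinal.IsRegular.aleph0_le Fact.out
  have := isCardinalFiltered_costructuredArrow_underlying hτ hV Λ hΛ X
  have := isFiltered_of_isCardinalFiltered
    (CostructuredArrow (isCardinalPresentableUnderlying V κ).ι X) κ
  obtain ⟨J, _, _, F, s, hs, _, ⟨hc⟩⟩ := exists_isColimit_coconeOfPoset κ (V.obj X).X
  rw [Functor.final_iff_of_isFiltered]
  refine ⟨fun d ↦ ?_, fun {d e} a b ↦ ?_⟩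
  · have : IsCardinalPresentable d.left.obj κ := d.left.property
    obtain ⟨j, f, hf⟩ : ∃ (j : J) (f : d.left.obj ⟶ F.obj j), f ≫ s j = d.hom :=
      IsCardinalPresentable.exists_hom_of_isColimit κ hc d.hom
    obtain ⟨B, q, -, hq, -⟩ := exists_costructuredArrow_factorization hτ hV Λ hΛ hc j
      (ι := Empty) (hasCardinalLT_of_finite _ _ hκ) (fun i ↦ i.elim) (fun i ↦ i.elim)
      (fun i ↦ i.elim)
    refine ⟨B, ⟨CostructuredArrow.homMk (ObjectProperty.homMk (f ≫ q)) ?_⟩⟩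
    change (f ≫ q) ≫ (V.map B.hom).hom = _
    rw [Category.assoc, hq, hf]
  · have : IsCardinalPresentable d.left.obj κ := d.left.property
    have : IsCardinalPresentable (V.obj e.left.obj).X κ := e.left.property
    obtain ⟨j, f, hf⟩ : ∃ (j : J) (f : (V.obj e.left.obj).X ⟶ F.obj j),
        f ≫ s j = (V.map e.hom).hom :=
      IsCardinalPresentable.exists_hom_of_isColimit (X := (V.obj e.left.obj).X) κ hc (V.map e.hom).hom
    let a' : d.left.obj ⟶ (V.obj e.left.obj).X := a.left.hom
    let b' : d.left.obj ⟶ (V.obj e.left.obj).X := b.left.hom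
    have ha' : a' ≫ (V.map e.hom).hom = d.hom := CostructuredArrow.w a
    have hb' : b' ≫ (V.map e.hom).hom = d.hom := CostructuredArrow.w b
    obtain ⟨k, h₁, h₂, h⟩ := exists_map_eq_of_isCardinalPresentable (κ := κ) hc
      (a' ≫ f) (b' ≫ f) (by rw [Category.assoc, Category.assoc, hf, ha', hb'])
    obtain ⟨B, q, g, -, hg⟩ := exists_costructuredArrow_factorization hτ hV Λ hΛ hc k
      (ι := Unit) (hasCardinalLT_of_finite _ _ hκ) (fun _ ↦ e)
      (fun _ ↦ f ≫ F.map (homOfLE h₁)) (fun _ ↦ by rw [Category.assoc, hs, hf])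
    refine ⟨B, g ⟨⟩, CostructuredArrow.hom_ext _ _ (ObjectProperty.hom_ext _ ?_)⟩
    change a' ≫ (V.map (g ⟨⟩).left.hom).hom = b' ≫ (V.map (g ⟨⟩).left.hom).hom
    simp only [Category.assoc] at h
    rw [hg, Category.assoc, reassoc_of% h]

/-- By finality, the canonical diagram over `X` has the same colimit in `M` as the dense diagram of
presentables, namely the underlying object of `X`; the forgetful functor and `V` reflect this. -/
lemma isCardinalFilteredGenerator_underlying :
    (isCardinalPresentableUnderlying V κ).IsCardinalFilteredGenerator κ where
  le_isCardinalPresentable X hX := by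
    have := isCardinalAccessible_of_essImage_comon V hτ hV κ
    have : IsCardinalPresentable (V.obj X).X κ := hX
    exact isCardinalPresentable_of_isCardinalPresentable_comon V κ X
  exists_colimitsOfShape X := by
    have : LocallySmall.{w} K := locallySmall_of_faithful (V ⋙ Comon.forget M)
    let E := CostructuredArrow (isCardinalPresentableUnderlying V κ).ι X
    have : IsCardinalFiltered E κ :=
      isCardinalFiltered_costructuredArrow_underlying hτ hV Λ hΛ X
    have := final_underlyingCostructuredArrow hτ hV Λ hΛ X
    let c : Cocone (CostructuredArrow.proj (isCardinalPresentableUnderlying V κ).ι X ⋙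
        (isCardinalPresentableUnderlying V κ).ι) :=
      { pt := X
        ι.app e := e.hom
        ι.naturality e e' f := (CostructuredArrow.w f).trans (Category.comp_id _).symm }
    have hc' := (Functor.Final.isColimitWhiskerEquiv (underlyingCostructuredArrow V κ X) _).symm
      ((isCardinalPresentable M κ).ι.denseAt (V.obj X).X)
    have hc : IsColimit c := isColimitOfReflects V (isColimitOfForgetComon
      (hc'.ofIsoColimit (Cocone.ext (Iso.refl _) fun e ↦
        (Category.comp_id _).trans (Category.id_comp _))))
    have hX : (isCardinalPresentableUnderlying V κ).colimitsOfShape E X :=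
      ⟨{ diag := _, ι := c.ι, isColimit := hc, prop_diag_obj := fun e ↦ e.left.property }⟩
    let e := equivSmallModel.{w} E
    refine ⟨SmallModel.{w} E, inferInstance, .of_equivalence κ e, ?_⟩
    rwa [← ObjectProperty.colimitsOfShape_congr _ e]

theorem isCardinalAccessibleCategory_of_essImage_comon :
    IsCardinalAccessibleCategory K κ ∧
      ∀ X : K, IsCardinalPresentable X κ ↔ IsCardinalPresentable (V.obj X).X κ := by
  have hP := isCardinalFilteredGenerator_underlying hτ hV Λ hΛ
  have : LocallySmall.{w} K := locallySmall_of_faithful (V ⋙ Comon.forget M)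
  have := hP.hasCardinalFilteredGenerator
  have := hasCardinalFilteredColimits_of_essImage_comon V hτ hV κ
  refine ⟨{ }, fun X ↦ ⟨fun hX ↦ ?_, fun hX ↦ hP.le_isCardinalPresentable X hX⟩⟩
  -- A presentable object is a retract of a generator, and retracts of presentable objects of `M`
  -- are presentable.
  obtain ⟨Y, hY, ⟨r⟩⟩ := hP.isPresentable_eq_retractClosure.le X hX
  exact (isCardinalPresentable M κ).prop_of_retract (r.map (V ⋙ Comon.forget M)) hY

end

end

end CategoryTheory

/-! ### The two cases: all comonoids and cocommutative comonoids. -/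

theorem theorem2p1 (M : Type u) [Category.{v} M] [MonoidalCategory M]
    (κ lam : Cardinal.{w}) [Fact κ.IsRegular]
    (hlam : Cardinal.aleph0 ≤ lam) (hlt : lam < κ)
    [IsCardinalAccessibleCategory M κ]
    [HasColimitsOfShape lam.ord.ToType M]
    [(MonoidalCategory.tensor M).IsCardinalAccessible κ] :
    (IsCardinalAccessibleCategory (Comon M) κ ∧
      ∀ C : Comon M, IsCardinalPresentable C κ ↔ IsCardinalPresentable C.X κ) ∧
    (∀ [SymmetricCategory M],
      IsCardinalAccessibleCategory (CommComon M) κ ∧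
        ∀ C : CommComon M, IsCardinalPresentable C κ ↔ IsCardinalPresentable C.X κ) := by
  have hΛ : HasCardinalLT lam.ord.ToType κ := by
    rwa [hasCardinalLT_iff_cardinal_mk_lt, Cardinal.mk_ord_toType]
  -- An infinite cardinal is a limit ordinal, as the closure of the chain requires.
  have : NoMaxOrder lam.ord.ToType := Cardinal.noMaxOrder hlam
  have : Nonempty lam.ord.ToType := by
    rw [← Cardinal.mk_ne_zero_iff, Cardinal.mk_ord_toType]
    exact (Cardinal.aleph0_pos.trans_le hlam).ne'
  refine ⟨isCardinalAccessibleCategory_of_essImage_comon (V := 𝟭 (Comon M)) (τ := fun X ↦ 𝟙 _)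
    (fun f ↦ by rw [Category.comp_id, Category.id_comp])
    (fun X ↦ ⟨fun _ ↦ Category.comp_id _, fun _ ↦ (𝟭 (Comon M)).obj_mem_essImage X⟩)
    lam.ord.ToType hΛ, fun {_} ↦ ?_⟩
  have : (CommComon.forget₂Comon M).Full := InducedCategory.full _
  have : (CommComon.forget₂Comon M).Faithful := InducedCategory.faithful _
  refine isCardinalAccessibleCategory_of_essImage_comon (V := CommComon.forget₂Comon M)
    (τ := fun X ↦ (β_ X X).hom) (fun f ↦ BraidedCategory.braiding_naturality f f)
    (fun X ↦ ⟨?_, fun h ↦ ?_⟩) lam.ord.ToType hΛ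
  · rintro ⟨Y, ⟨e⟩⟩
    have h : ComonObj.comul (X := Y.X) ≫ (β_ Y.X Y.X).hom = ComonObj.comul := IsCommComonObj.comul_comm Y.X
    let i : Y.X ≅ X.X := (Comon.forget M).mapIso e
    have hi : IsComonHom i.hom := inferInstanceAs (IsComonHom e.hom.hom)
    rw [← cancel_epi i.hom, IsComonHom.hom_comul_assoc, BraidedCategory.braiding_naturality,
      reassoc_of% h, IsComonHom.hom_comul]
  · have : IsCommComonObj X.X := ⟨h⟩
    exact ⟨⟨X.X⟩, ⟨Iso.refl _⟩⟩
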